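/- For integers $t\ge 2$ and $\lambda\ge 1$ let $H(2t,\lambda)=C_{2t}\odot\lambda K_1$ be the corona of the cycle $C_{2t}$ with $\lambda K_1$, that is, the graph with $2t(\lambda+1)$ edges obtained from a cycle of length $2t$ by attaching $\lambda$ pendant edges at every vertex of the cycle. Let $K_{m\times q}$ denote the complete $m$-partite graph with parts of size $q$. A $\Gamma$-decomposition of a graph $K$ is a set of subgraphs of $K$ (blocks), each isomorphic to $\Gamma$, whose edge sets partition the edge set of $K$; it is cyclic if it is invariant under a cyclic permutation of all the vertices of $K$, i.e. a permutation of $V(K)$ consisting of a single cycle through all the vertices. Theorem. For all integers $t\ge 2$ and $\lambda\ge 1$, every positive divisor $d$ of $2t(\lambda+1)$ and every positive integer $n$, there exists a cyclic $H(2t,\lambda)$-decomposition of $$K_{\left(\frac{2t(\lambda+1)}{d}+1\right)\times 2dn}.$$ -/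

import Mathlib

/-- The corona `G ⊙ H`: one copy of `G` together with one copy of `H` for every vertex `v` of `G`
(the copy attached to `v` has the vertices `(v, w)`), where `v` is joined to all the vertices of
its own copy of `H`. -/
def corona {V W : Type*} (G : SimpleGraph V) (H : SimpleGraph W) : SimpleGraph (V ⊕ V × W) where
  Adj
    | .inl u, .inl v => G.Adj u v
    | .inl u, .inr p => u = p.1
    | .inr p, .inl v => p.1 = v
    | .inr p, .inr q => p.1 = q.1 ∧ H.Adj p.2 q.2
  symm := ⟨by
    rintro (u | p) (v | q) h
    · exact G.adj_symm h
    · exact h.symm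
    · exact h.symm
    · exact ⟨h.1.symm, H.adj_symm h.2⟩⟩
  loopless := ⟨by
    rintro (u | p) h
    · exact G.irrefl h
    · exact H.irrefl h.2⟩

/-- The hairy cycle `H(2t, lam)`, that is, the corona `C_{2t} ⊙ lam K₁`: a cycle of length `2t`
with `lam` pendant edges at every vertex of the cycle. -/
def hairyCycle (t lam : ℕ) : SimpleGraph (Fin (2 * t) ⊕ Fin (2 * t) × Fin lam) :=
  corona (SimpleGraph.cycleGraph (2 * t)) (⊥ : SimpleGraph (Fin lam))

/-- A set `B` of subgraphs of `K` is a `Γ`-decomposition of `K` if all its members (the blocks) are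
isomorphic to `Γ` and every edge of `K` lies in exactly one block. -/
def IsDecomposition {V W : Type*} (Γ : SimpleGraph W) (K : SimpleGraph V)
    (B : Set K.Subgraph) : Prop :=
  (∀ S ∈ B, Nonempty (S.coe ≃g Γ)) ∧ ∀ e ∈ K.edgeSet, ∃! S, S ∈ B ∧ e ∈ S.edgeSet

/-- A set of subgraphs of `K` is cyclic if some permutation of the vertices of `K`, which is a
single cycle through all the vertices and an automorphism of `K`, maps the set onto itself. -/
def IsCyclicFamily {V : Type*} (K : SimpleGraph V) (B : Set K.Subgraph) : Prop :=
  ∃ σ : K ≃g K, Equiv.Perm.IsCycleOn σ.toEquiv Set.univ ∧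
    (fun S : K.Subgraph => S.map σ.toHom) '' B = B

/-! Put k = λ + 1, 2tk = dm, r = m + 1, T = dr and N = 2nT. The equipartite graph is the Cayley
graph of ℤ/N whose connection set is the non-multiples of r, so base blocks whose oriented
differences hit each such residue once give a cyclic decomposition by translation. Exactly dm =
|E(H)| non-multiples of r lie between 0 and T. If an injective labelling of H, with one bipartition
class below the other, realises each of them on one edge, then raising the upper class by iT for i <
n gives n base blocks covering the non-multiples below nT; reversing edges supplies the negatives
(`exists_cyclic_decomposition_of_alpha_labeling`).

The labelling zigzags: along the cycle, decreasing differences are alternately added and subtracted,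
and the hairs at a vertex take differences between those of its two cycle edges. Labels then
increase along the lower class and decrease along the upper one, which gives injectivity
(`exists_cyclic_decomposition_of_zigzag`). What remains is closure: the alternating sum over the
path must equal the difference of the closing edge.

List the non-multiples decreasingly as D(0), D(1), … and deal the ranks out in blocks of k, the λ
hairs at a vertex and then the next cycle edge, reserving rank tk for the closing edge. Since D(i) +
D(dm−1−i) = T, the path edges pair off about the middle one. The sum is T − D(tk−1) = D(tk) for even
t, as needed, but D(tk−1) for odd t. That excess, 2 or 1 according to whether m ∣ tk, is removed by
giving one hair at an odd vertex a difference so large that its label is negative, hence meets no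
other, and moving the intermediate ranks by one. `exists_cyclic_decomposition_of_shift` and
`exists_cyclic_decomposition_of_minimal` do this in complementary cases. -/

/-! ### From differences and α-labellings to cyclic decompositions. -/

/-- Base blocks `F i` in `ZMod N` whose differences cover each admissible difference exactly once
give a cyclic decomposition by taking all their translates. -/
theorem exists_cyclic_decomposition_of_differences {V W ι : Type*} {N : ℕ} [NeZero N]
    (Γ : SimpleGraph W) (K : SimpleGraph V) (P : ZMod N → Prop) (φ : V ≃ ZMod N)
    (hK : ∀ v w, K.Adj v w ↔ P (φ w - φ v)) (F : ι → W → ZMod N)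
    (hinj : ∀ i, Function.Injective (F i))
    (hP : ∀ i a b, Γ.Adj a b → P (F i b - F i a))
    (hex : ∀ δ, P δ → ∃ i a b, Γ.Adj a b ∧ F i b - F i a = δ)
    (huniq : ∀ i i' a b a' b', Γ.Adj a b → Γ.Adj a' b' →
      F i b - F i a = F i' b' - F i' a' → i = i' ∧ a = a') :
    ∃ B : Set K.Subgraph, IsDecomposition Γ K B ∧ IsCyclicFamily K B := by
  let C : ι × ZMod N → SimpleGraph.Copy Γ K := fun p =>
    ⟨⟨fun w => φ.symm (F p.1 w + p.2), fun {a b} h => by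
      rw [hK]; simpa using hP p.1 a b h⟩,
      fun a b h => hinj p.1 (by simpa using h)⟩
  have hC : ∀ p w, C p w = φ.symm (F p.1 w + p.2) := fun p w => rfl
  have hadj : ∀ p v w, (C p).toSubgraph.Adj v w ↔
      ∃ a b, Γ.Adj a b ∧ F p.1 a + p.2 = φ v ∧ F p.1 b + p.2 = φ w := by
    intro p v w
    simp only [SimpleGraph.Copy.toSubgraph, SimpleGraph.Subgraph.map_adj, Relation.Map,
      SimpleGraph.Subgraph.top_adj, SimpleGraph.Copy.toHom_apply, hC, Equiv.symm_apply_eq]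
  refine ⟨Set.range fun p => (C p).toSubgraph, ⟨?_, ?_⟩, ?_⟩
  · rintro _ ⟨p, rfl⟩
    exact ⟨(C p).isoToSubgraph.symm⟩
  · intro e
    induction e using Sym2.ind with
    | _ v w =>
    intro he
    rw [SimpleGraph.mem_edgeSet, hK] at he
    obtain ⟨i, a, b, hab, hd⟩ := hex _ he
    refine ⟨(C (i, φ v - F i a)).toSubgraph, ⟨⟨_, rfl⟩, ?_⟩, ?_⟩
    · rw [SimpleGraph.Subgraph.mem_edgeSet, hadj]
      refine ⟨a, b, hab, by simp, ?_⟩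
      simp only
      linear_combination hd
    · rintro _ ⟨⟨⟨i', g⟩, rfl⟩, hS⟩
      simp only [SimpleGraph.Subgraph.mem_edgeSet, hadj] at hS
      obtain ⟨a', b', hab', h1, h2⟩ := hS
      obtain ⟨rfl, rfl⟩ := huniq i' i a' b' a b hab' hab (by rw [hd, ← h1, ← h2]; ring)
      have : g = φ v - F i' a' := by rw [← h1]; ring
      rw [this]
  · let s : V ≃ V := (φ.trans (Equiv.addRight 1)).trans φ.symm
    have hs : ∀ v, φ (s v) = φ v + 1 := fun v => by simp [s]
    let σ : K ≃g K := ⟨s, fun {a b} => by rw [hK, hK, hs, hs]; simp⟩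
    have hpow : ∀ (j : ℕ) v, φ ((s ^ j : Equiv.Perm V) v) = φ v + j := by
      intro j
      induction j with
      | zero => simp
      | succ j ih =>
        intro v
        rw [pow_succ', Equiv.Perm.mul_apply, hs, ih]
        push_cast; ring
    have hmap : ∀ p : ι × ZMod N, (C p).toSubgraph.map σ.toHom = (C (p.1, p.2 + 1)).toSubgraph := by
      intro p
      have hcomp : ∀ w, σ.toHom (C p w) = C (p.1, p.2 + 1) w := by
        intro w
        apply φ.injective
        rw [hC, hC]
        change φ (s _) = _
        rw [hs]; simp; ring
      unfold SimpleGraph.Copy.toSubgraph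
      rw [← SimpleGraph.Subgraph.map_comp]
      congr 1
      ext w
      exact hcomp w
    refine ⟨σ, ⟨σ.toEquiv.bijective.bijOn_univ, ?_⟩, ?_⟩
    · intro v _ w _
      refine ⟨((φ w - φ v).val : ℤ), φ.injective ?_⟩
      rw [zpow_natCast]
      refine (hpow _ v).trans ?_
      simp
    · ext S
      constructor
      · rintro ⟨_, ⟨p, rfl⟩, rfl⟩
        exact ⟨_, (hmap p).symm⟩
      · rintro ⟨p, rfl⟩
        exact ⟨_, ⟨(p.1, p.2 - 1), rfl⟩, by simp only [hmap]; simp⟩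

/-- A labelling `f` of a bipartite graph, with all the labels of the class `A` below those of the
other class, whose edge differences `f (β e) - f (α e)` are exactly the non-multiples of `r` below
`d * r`, gives a cyclic decomposition of the complete equipartite graph with `r` parts of
size `2 * d * n`. -/
theorem exists_cyclic_decomposition_of_alpha_labeling {W E : Type*} (Γ : SimpleGraph W)
    (d r n : ℕ) (hd : 0 < d) (hr : 0 < r) (hn : 0 < n)
    (A : Set W) (α β : E → W) (hα : ∀ e, α e ∈ A) (hβ : ∀ e, β e ∉ A)
    (hadj : ∀ a b, Γ.Adj a b ↔ ∃ e, a = α e ∧ b = β e ∨ a = β e ∧ b = α e)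
    (f : W → ℤ) (hf : Function.Injective f)
    (hlow : ∀ a, -((d * r : ℕ) : ℤ) < f a) (hupp : ∀ a, f a < (d * r : ℕ))
    (hAB : ∀ a b, a ∈ A → b ∉ A → f a < f b)
    (winj : ∀ e e', f (β e) - f (α e) = f (β e') - f (α e') → e = e')
    (wlt : ∀ e, f (β e) - f (α e) < (d * r : ℕ))
    (wdvd : ∀ e, ¬ (r : ℤ) ∣ f (β e) - f (α e))
    (wsurj : ∀ x : ℤ, 0 < x → x < (d * r : ℕ) → ¬ (r : ℤ) ∣ x → ∃ e, f (β e) - f (α e) = x) :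
    ∃ B : Set (SimpleGraph.completeEquipartiteGraph r (2 * d * n)).Subgraph,
      IsDecomposition Γ (SimpleGraph.completeEquipartiteGraph r (2 * d * n)) B ∧
      IsCyclicFamily (SimpleGraph.completeEquipartiteGraph r (2 * d * n)) B := by
  classical
  set T : ℤ := ((d * r : ℕ) : ℤ) with hT
  have hTpos : 0 < T := by rw [hT]; exact_mod_cast Nat.mul_pos hd hr
  obtain ⟨N, hN⟩ : ∃ N, N = 2 * d * n * r := ⟨_, rfl⟩
  have hNT : (N : ℤ) = 2 * (n * T) := by rw [hN, hT]; push_cast; ring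
  have hnT : T ≤ n * T := le_mul_of_one_le_left hTpos.le (by exact_mod_cast hn)
  have hN0 : NeZero N := ⟨by rw [hN]; positivity⟩
  have hrN : r ∣ N := ⟨2 * d * n, by rw [hN]; ring⟩
  have hrT : (r : ℤ) ∣ T := ⟨d, by rw [hT]; push_cast; ring⟩
  have wpos : ∀ e, 0 < f (β e) - f (α e) := fun e => sub_pos.2 (hAB _ _ (hα e) (hβ e))
  let c := ZMod.castHom hrN (ZMod r)
  -- Raising only the upper class adds `i * T` to every edge difference; as `T` is a multiple of
  -- `r`, residues modulo `r` are kept.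
  let G : Fin n → W → ℤ := fun i w => f w + if w ∈ A then 0 else (i : ℕ) * T
  have hcast : ∀ z : ℤ, c (z : ZMod N) = 0 ↔ (r : ℤ) ∣ z := fun z => by
    rw [map_intCast, ZMod.intCast_zmod_eq_zero_iff_dvd]
  have hiT : ∀ i : Fin n, 0 ≤ ((i : ℕ) : ℤ) * T ∧ ((i : ℕ) : ℤ) * T + T ≤ n * T := by
    intro i
    refine ⟨by positivity, ?_⟩
    have : ((i : ℕ) : ℤ) + 1 ≤ n := by exact_mod_cast i.2
    nlinarith
  have hGdiff : ∀ i e, G i (β e) - G i (α e) = f (β e) - f (α e) + (i : ℕ) * T := by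
    intro i e
    simp only [G, hα e, hβ e, if_true, if_false]; ring
  have eq_of_cast : ∀ y z : ℤ, (y : ZMod N) = z → |y - z| < N → y = z := by
    intro y z h hlt
    have := (ZMod.intCast_eq_intCast_iff_dvd_sub _ _ _).1 h.symm
    linarith [Int.eq_zero_of_abs_lt_dvd this hlt]
  -- The parts become the residue classes modulo `r`.
  let φ₀ : Fin r × Fin (2 * d * n) → ZMod N := fun v => ((v.1 + r * v.2 : ℕ) : ZMod N)
  have hφ : Function.Bijective φ₀ := by
    rw [Fintype.bijective_iff_injective_and_card]
    constructor
    · rintro ⟨a, b⟩ ⟨a', b'⟩ h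
      have hlt : ∀ (a : Fin r) (b : Fin (2 * d * n)), (a : ℕ) + r * b < N := by
        intro a b
        rw [hN]
        have h1 := a.2
        have h2 : (b : ℕ) + 1 ≤ 2 * d * n := b.2
        have := Nat.mul_le_mul_right r h2
        nlinarith
      have h := (ZMod.natCast_eq_natCast_iff' _ _ _).1 h
      simp only [Nat.mod_eq_of_lt (hlt _ _)] at h
      have h1 : (a : ℕ) = a' := by
        have := congrArg (· % r) h
        simpa [Nat.add_mul_mod_self_left, Nat.mod_eq_of_lt] using this
      have h2 : (b : ℕ) = b' := by
        rw [h1] at h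
        exact Nat.eq_of_mul_eq_mul_left hr (by omega)
      exact Prod.ext (Fin.ext h1) (Fin.ext h2)
    · simp [ZMod.card, hN, mul_comm]
  refine exists_cyclic_decomposition_of_differences Γ _ (fun δ => c δ ≠ 0)
    (Equiv.ofBijective φ₀ hφ) ?_ (fun i w => ((G i w : ℤ) : ZMod N)) ?_ ?_ ?_ ?_
  · intro v w
    rw [SimpleGraph.completeEquipartiteGraph_adj, map_sub, sub_ne_zero]
    have hc : ∀ v, c (φ₀ v) = ((v.1 : ℕ) : ZMod r) := fun v => by
      change c ((_ : ℕ) : ZMod N) = _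
      rw [map_natCast]; simp
    change _ ↔ c (φ₀ w) ≠ c (φ₀ v)
    rw [hc, hc, Ne, Ne, ZMod.natCast_eq_natCast_iff', Nat.mod_eq_of_lt w.1.2,
      Nat.mod_eq_of_lt v.1.2, Fin.ext_iff, eq_comm]
  · intro i a b h
    have h1 := hlow a
    have h2 := hlow b
    have h3 := hupp a
    have h4 := hupp b
    have h5 := hAB a b
    have h6 := hAB b a
    obtain ⟨h7, h8⟩ := hiT i
    apply hf
    have := eq_of_cast _ _ h
    simp only [G, abs_lt] at this
    by_cases ha : a ∈ A <;> by_cases hb : b ∈ A <;>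
      simp only [ha, hb, if_true, if_false, true_imp_iff, not_true, not_false_iff] at this h5 h6 <;>
      have := this ⟨by linarith, by linarith⟩ <;> linarith
  · intro i a b hab
    rw [← Int.cast_sub, Ne, hcast]
    obtain ⟨e, ⟨rfl, rfl⟩ | ⟨rfl, rfl⟩⟩ := (hadj a b).1 hab
    · rw [hGdiff, dvd_add_left (hrT.mul_left _)]
      exact wdvd e
    · rw [← neg_sub, hGdiff, dvd_neg, dvd_add_left (hrT.mul_left _)]
      exact wdvd e
  · have key : ∀ z : ℤ, 0 < z → z < n * T → ¬ (r : ℤ) ∣ z → ∃ i e, G i (β e) - G i (α e) = z := by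
      intro z hz hz' hrz
      have hmod : ¬ (r : ℤ) ∣ z % T := fun h => hrz (by
        have := dvd_add h (hrT.mul_right (z / T))
        rwa [Int.emod_add_mul_ediv] at this)
      have h0 : 0 < z % T := lt_of_le_of_ne (Int.emod_nonneg _ hTpos.ne') fun h =>
        hmod (h ▸ dvd_zero _)
      obtain ⟨e, he⟩ := wsurj _ h0 (Int.emod_lt_of_pos _ hTpos) hmod
      have hq : z / T < n := Int.ediv_lt_of_lt_mul hTpos hz'
      have hq0 : 0 ≤ z / T := Int.ediv_nonneg hz.le hTpos.le
      refine ⟨⟨(z / T).toNat, by omega⟩, e, ?_⟩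
      rw [hGdiff, he]
      simp only [Int.toNat_of_nonneg hq0]
      linarith [Int.emod_add_mul_ediv z T, mul_comm T (z / T)]
    intro δ hδ
    obtain ⟨z, rfl, hz1, hz2⟩ : ∃ z : ℤ, (z : ZMod N) = δ ∧ -(n * T) ≤ z ∧ z ≤ n * T := by
      refine ⟨δ.valMinAbs, ZMod.coe_valMinAbs δ, ?_, ?_⟩
      · have := (ZMod.valMinAbs_mem_Ioc δ).1
        linarith
      · have := (ZMod.valMinAbs_mem_Ioc δ).2
        linarith
    have hz := (hcast z).not.1 hδ
    have hz0 : z ≠ 0 := fun h => hz (h ▸ dvd_zero _)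
    -- The involution `n * T` of `ZMod N` is a multiple of `r`, so no difference is its own
    -- negative.
    have hne1 : z ≠ n * T := fun h => hz (h ▸ hrT.mul_left _)
    have hne2 : z ≠ -(n * T) := fun h => hz (h ▸ (hrT.mul_left _).neg_right)
    rcases lt_or_gt_of_ne hz0 with h | h
    · obtain ⟨i, e, he⟩ := key (-z) (by omega) (by have := lt_of_le_of_ne hz1 hne2.symm; linarith)
        (by rwa [dvd_neg])
      refine ⟨i, β e, α e, (hadj _ _).2 ⟨e, Or.inr ⟨rfl, rfl⟩⟩, ?_⟩
      rw [← Int.cast_sub, ← neg_sub, he, neg_neg]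
    · obtain ⟨i, e, he⟩ := key z h (lt_of_le_of_ne hz2 hne1) hz
      refine ⟨i, α e, β e, (hadj _ _).2 ⟨e, Or.inl ⟨rfl, rfl⟩⟩, ?_⟩
      rw [← Int.cast_sub, he]
  · have key : ∀ (i i' : Fin n) e e', f (β e) - f (α e) + (i : ℕ) * T =
        f (β e') - f (α e') + (i' : ℕ) * T → i = i' ∧ e = e' := by
      intro i i' e e' h
      -- Edge differences lie strictly between 0 and `T`: the remainder modulo `T` identifies the
      -- edge, the quotient the block.
      have hm := congrArg (· % T) h
      simp only [Int.add_mul_emod_self_right, Int.emod_eq_of_lt (wpos _).le (wlt _)] at hm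
      rw [hm] at h
      have h2 : ((i : ℕ) : ℤ) = (i' : ℕ) := mul_right_cancel₀ hTpos.ne' (add_left_cancel h)
      exact ⟨Fin.ext (by exact_mod_cast h2), winj _ _ hm⟩
    intro i i' a b a' b' hab hab' h
    rw [← Int.cast_sub, ← Int.cast_sub] at h
    replace h := eq_of_cast _ _ h
    rw [abs_lt] at h
    obtain ⟨e, ⟨rfl, rfl⟩ | ⟨rfl, rfl⟩⟩ := (hadj a b).1 hab <;>
    obtain ⟨e', ⟨rfl, rfl⟩ | ⟨rfl, rfl⟩⟩ := (hadj a' b').1 hab' <;>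
    have g1 := hGdiff i e <;> have g2 := hGdiff i' e' <;>
    have p1 := wpos e <;> have p2 := wpos e' <;> have l1 := wlt e <;> have l2 := wlt e' <;>
    have q1 := hiT i <;> have q2 := hiT i' <;>
    replace h := h ⟨by linarith, by linarith⟩
    · obtain ⟨rfl, rfl⟩ := key i i' e e' (by linarith)
      exact ⟨rfl, rfl⟩
    -- Oppositely oriented edges have differences of opposite signs.
    · linarith
    · linarith
    · obtain ⟨rfl, rfl⟩ := key i i' e e' (by linarith)
      exact ⟨rfl, rfl⟩

/-! ### Edges and bipartition of the hairy cycle. -/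

/-- The successor of a vertex on the cycle with vertex set `Fin m`. -/
def cycleSucc {m : ℕ} (j : Fin m) : Fin m :=
  if h : (j : ℕ) + 1 < m then ⟨j + 1, h⟩ else ⟨0, j.pos⟩

theorem cycleGraph_adj_iff_cycleSucc {m : ℕ} (hm : 2 ≤ m) (u v : Fin m) :
    (SimpleGraph.cycleGraph m).Adj u v ↔ v = cycleSucc u ∨ u = cycleSucc v := by
  obtain ⟨u, hu⟩ := u
  obtain ⟨v, hv⟩ := v
  have key : ∀ a b (ha : a < m) (hb : b < m), ((⟨a, ha⟩ : Fin m) - ⟨b, hb⟩).val = 1 ↔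
      (⟨a, ha⟩ : Fin m) = cycleSucc ⟨b, hb⟩ := by
    intro a b ha hb
    rw [Fin.sub_def]
    simp only [cycleSucc]
    split_ifs with h <;> rw [Fin.mk.injEq]
    · rcases lt_or_ge a b with h1 | h1
      · rw [Nat.mod_eq_of_lt (by omega)]; omega
      · rw [show m - b + a = (a - b) + m by omega, Nat.add_mod_right, Nat.mod_eq_of_lt (by omega)]
        omega
    · rcases lt_or_ge a b with h1 | h1
      · rw [Nat.mod_eq_of_lt (by omega)]; omega
      · rw [show m - b + a = (a - b) + m by omega, Nat.add_mod_right, Nat.mod_eq_of_lt (by omega)]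
        omega
  rw [SimpleGraph.cycleGraph_adj', key, key, or_comm]

theorem even_cycleSucc {t : ℕ} (j : Fin (2 * t)) :
    Even (cycleSucc j : ℕ) ↔ ¬ Even (j : ℕ) := by
  have := j.2
  simp only [cycleSucc]
  split_ifs with h
  · simp [Nat.even_add_one]
  · have : (j : ℕ) + 1 = 2 * t := by omega
    simp only [Nat.even_iff, Nat.zero_mod, true_iff]; omega

/-- The edges of the hairy cycle: `inl j` joins the cycle vertex `j` to its successor, and
`inr (j, i)` is the `i`-th hair at `j`. -/
abbrev HairyEdge (t lam : ℕ) := Fin (2 * t) ⊕ Fin (2 * t) × Fin lam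

/-- The class of the bipartition of the hairy cycle that contains the even cycle vertices. -/
def lowerClass (t lam : ℕ) : Set (Fin (2 * t) ⊕ Fin (2 * t) × Fin lam) :=
  {v | Sum.elim (fun j : Fin (2 * t) => Even (j : ℕ))
    (fun p : Fin (2 * t) × Fin lam => ¬ Even (p.1 : ℕ)) v}

/-- The endpoint of an edge in the lower class. -/
def lowerEnd {t lam : ℕ} : HairyEdge t lam → Fin (2 * t) ⊕ Fin (2 * t) × Fin lam
  | .inl j => if Even (j : ℕ) then .inl j else .inl (cycleSucc j)
  | .inr p => if Even (p.1 : ℕ) then .inl p.1 else .inr p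

/-- The endpoint of an edge outside the lower class. -/
def upperEnd {t lam : ℕ} : HairyEdge t lam → Fin (2 * t) ⊕ Fin (2 * t) × Fin lam
  | .inl j => if Even (j : ℕ) then .inl (cycleSucc j) else .inl j
  | .inr p => if Even (p.1 : ℕ) then .inr p else .inl p.1

theorem lowerEnd_mem {t lam : ℕ} (e : HairyEdge t lam) : lowerEnd e ∈ lowerClass t lam := by
  rcases e with j | p <;> simp only [lowerEnd, lowerClass, Set.mem_ofPred_eq] <;>
    split_ifs with h <;> simp [-Nat.not_even_iff_odd, h, even_cycleSucc]

theorem upperEnd_notMem {t lam : ℕ} (e : HairyEdge t lam) : upperEnd e ∉ lowerClass t lam := by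
  rcases e with j | p <;> simp only [upperEnd, lowerClass, Set.mem_ofPred_eq] <;>
    split_ifs with h <;> simp [-Nat.not_even_iff_odd, h, even_cycleSucc]

theorem hairyCycle_adj_iff {t lam : ℕ} (ht : 1 ≤ t) (a b : Fin (2 * t) ⊕ Fin (2 * t) × Fin lam) :
    (hairyCycle t lam).Adj a b ↔
      ∃ e, a = lowerEnd e ∧ b = upperEnd e ∨ a = upperEnd e ∧ b = lowerEnd e := by
  have hE : ∀ e : HairyEdge t lam, (lowerEnd e = Sum.elim Sum.inl (fun p => .inl p.1) e ∧
      upperEnd e = Sum.elim (fun j => .inl (cycleSucc j)) Sum.inr e) ∨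
      (upperEnd e = Sum.elim Sum.inl (fun p => .inl p.1) e ∧
      lowerEnd e = Sum.elim (fun j => .inl (cycleSucc j)) Sum.inr e) := by
    rintro (j | p) <;> simp only [lowerEnd, upperEnd] <;> split_ifs <;> simp
  have hE' : ∀ e : HairyEdge t lam,
      (a = lowerEnd e ∧ b = upperEnd e ∨ a = upperEnd e ∧ b = lowerEnd e) ↔
      (a = Sum.elim Sum.inl (fun p => .inl p.1) e ∧
        b = Sum.elim (fun j => .inl (cycleSucc j)) Sum.inr e ∨
      a = Sum.elim (fun j => .inl (cycleSucc j)) Sum.inr e ∧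
        b = Sum.elim Sum.inl (fun p => .inl p.1) e) := by
    intro e
    rcases hE e with ⟨h1, h2⟩ | ⟨h1, h2⟩ <;> rw [h1, h2]
    exact or_comm
  simp only [hE', Sum.exists, Sum.elim_inl, Sum.elim_inr]
  rcases a with u | p <;> rcases b with v | q <;>
    simp [hairyCycle, corona, cycleGraph_adj_iff_cycleSucc (show 2 ≤ 2 * t by omega)]
  · constructor
    · rintro (rfl | rfl)
      · exact ⟨u, Or.inl ⟨rfl, rfl⟩⟩
      · exact ⟨v, Or.inr ⟨rfl, rfl⟩⟩
    · rintro ⟨w, ⟨rfl, rfl⟩ | ⟨rfl, rfl⟩⟩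
      · exact Or.inl rfl
      · exact Or.inr rfl
  · exact eq_comm

/-! ### Zigzag labellings. -/

/-- The vertex labels of the hairy cycle determined by the labels `x` of the cycle vertices and the
differences `η` of the hairs. -/
def hairyLabel {t lam : ℕ} (x : ℕ → ℤ) (η : ℕ → ℕ → ℤ) :
    Fin (2 * t) ⊕ Fin (2 * t) × Fin lam → ℤ
  | .inl j => x j
  | .inr p => if Even (p.1 : ℕ) then x p.1 + η p.1 p.2 else x p.1 - η p.1 p.2

/-- The position on the cycle of a vertex of the hairy cycle. -/
def hairyPos {t lam : ℕ} : Fin (2 * t) ⊕ Fin (2 * t) × Fin lam → ℕ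
  | .inl j => j
  | .inr p => p.1

/-- The value at an edge of the hairy cycle of the function that is `δ` on the cycle and `η` on the
hairs. -/
def edgeValue {t lam : ℕ} {γ : Type*} (δ : ℕ → γ) (η : ℕ → ℕ → γ) : HairyEdge t lam → γ
  | .inl j => δ j
  | .inr p => η p.1 p.2

/-- A zigzag labelling of the hairy cycle. The cycle edges have differences `δ`, decreasing along
the cycle apart from the closing edge, and the hairs at `j` have differences `η j i` that lie
between those of the two cycle edges at `j`, except for at most one exceptional hair, which gets a
negative label. -/
theorem exists_cyclic_decomposition_of_zigzag (t lam d r n : ℕ) (ht : 1 ≤ t)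
    (hd : 0 < d) (hr : 0 < r) (hn : 0 < n)
    (x δ : ℕ → ℤ) (η : ℕ → ℕ → ℤ) (S : ℕ → ℕ → Prop)
    (hx0 : x 0 = 0)
    (hxe : ∀ j, j + 1 < 2 * t → Even j → x (j + 1) = x j + δ j)
    (hxo : ∀ j, j + 1 < 2 * t → ¬ Even j → x (j + 1) = x j - δ j)
    (hclose : x (2 * t - 1) = δ (2 * t - 1))
    (hanti : ∀ j, j + 2 < 2 * t → δ (j + 1) < δ j)
    (hδη : ∀ j i, j + 1 < 2 * t → i < lam → ¬ S j i → δ j < η j i)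
    (hηδ : ∀ j i, j + 1 < 2 * t → i < lam → ¬ S (j + 1) i → η (j + 1) i < δ j)
    (hS : ∀ j i, j < 2 * t → i < lam → S j i → ¬ Even j ∧ x j < η j i)
    (hSu : ∀ j i j' i', S j i → S j' i' → j = j')
    (hδpos : ∀ j, j < 2 * t → 0 < δ j) (hδlt : ∀ j, j < 2 * t → δ j < (d * r : ℕ))
    (hηpos : ∀ j i, j < 2 * t → i < lam → 0 < η j i)
    (hηlt : ∀ j i, j < 2 * t → i < lam → η j i < (d * r : ℕ))
    (hinj : Function.Injective (edgeValue δ η : HairyEdge t lam → ℤ))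
    (hdvd : ∀ e : HairyEdge t lam, ¬ (r : ℤ) ∣ edgeValue δ η e)
    (hsurj : ∀ z : ℤ, 0 < z → z < (d * r : ℕ) → ¬ (r : ℤ) ∣ z →
      ∃ e : HairyEdge t lam, edgeValue δ η e = z) :
    ∃ B : Set (SimpleGraph.completeEquipartiteGraph r (2 * d * n)).Subgraph,
      IsDecomposition (hairyCycle t lam)
        (SimpleGraph.completeEquipartiteGraph r (2 * d * n)) B ∧
      IsCyclicFamily (SimpleGraph.completeEquipartiteGraph r (2 * d * n)) B := by
  set T : ℤ := ((d * r : ℕ) : ℤ) with hT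
  have hTpos : 0 < T := by rw [hT]; exact_mod_cast Nat.mul_pos hd hr
  -- Two steps from an even vertex add `δ a - δ (a + 1) > 0`; from an odd vertex they subtract it.
  have xmono : ∀ b a, a + 2 * b < 2 * t → Even a → x a ≤ x (a + 2 * b) ∧
      (0 < b → x a < x (a + 2 * b)) := by
    intro b
    induction b with
    | zero => intro a _ _; simp
    | succ b ih =>
      intro a hb ha
      have h1 := (ih a (by omega) ha).1
      have h2 := hxe (a + 2 * b) (by omega) (by simp [Nat.even_add, ha])
      have h3 := hxo (a + 2 * b + 1) (by omega) (by simp [Nat.even_add, ha])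
      have h4 := hanti (a + 2 * b) (by omega)
      rw [show a + 2 * (b + 1) = a + 2 * b + 1 + 1 by ring]
      constructor <;> intros <;> linarith
  have xanti : ∀ b a, a + 2 * b < 2 * t → ¬ Even a → x (a + 2 * b) ≤ x a ∧
      (0 < b → x (a + 2 * b) < x a) := by
    intro b
    induction b with
    | zero => intro a _ _; simp
    | succ b ih =>
      intro a hb ha
      have h1 := (ih a (by omega) ha).1
      have h2 := hxo (a + 2 * b) (by omega) (by simpa [Nat.even_add] using ha)
      have h3 := hxe (a + 2 * b + 1) (by omega) (by simpa [Nat.even_add] using ha)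
      have h4 := hanti (a + 2 * b) (by omega)
      rw [show a + 2 * (b + 1) = a + 2 * b + 1 + 1 by ring]
      constructor <;> intros <;> linarith
  have mono_le : ∀ a b, a ≤ b → b < 2 * t → Even a → Even b → x a ≤ x b := by
    intro a b hab hb ha hb'
    obtain ⟨c, rfl⟩ : ∃ c, b = a + 2 * c := ⟨(b - a) / 2, by
      rw [Nat.even_iff] at ha hb'; omega⟩
    exact (xmono c a hb ha).1
  have mono_lt : ∀ a b, a < b → b < 2 * t → Even a → Even b → x a < x b := by
    intro a b hab hb ha hb'
    obtain ⟨c, rfl⟩ : ∃ c, b = a + 2 * c := ⟨(b - a) / 2, by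
      rw [Nat.even_iff] at ha hb'; omega⟩
    exact (xmono c a hb ha).2 (by omega)
  have anti_le : ∀ a b, a ≤ b → b < 2 * t → ¬ Even a → ¬ Even b → x b ≤ x a := by
    intro a b hab hb ha hb'
    obtain ⟨c, rfl⟩ : ∃ c, b = a + 2 * c := ⟨(b - a) / 2, by
      rw [Nat.even_iff] at ha hb'; omega⟩
    exact (xanti c a hb ha).1
  have anti_lt : ∀ a b, a < b → b < 2 * t → ¬ Even a → ¬ Even b → x b < x a := by
    intro a b hab hb ha hb'
    obtain ⟨c, rfl⟩ : ∃ c, b = a + 2 * c := ⟨(b - a) / 2, by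
      rw [Nat.even_iff] at ha hb'; omega⟩
    exact (xanti c a hb ha).2 (by omega)
  have hlast : ¬ Even (2 * t - 1) := by rw [Nat.even_iff]; omega
  have hlast' : Even (2 * t - 2) := by rw [Nat.even_iff]; omega
  have hmid : x (2 * t - 2) < x (2 * t - 1) := by
    have h1 := hxe (2 * t - 2) (by omega) hlast'
    have h2 := hδpos (2 * t - 2) (by omega)
    rw [show 2 * t - 2 + 1 = 2 * t - 1 by omega] at h1
    linarith
  have even_nonneg : ∀ j, j < 2 * t → Even j → 0 ≤ x j := fun j hj he => by
    have := mono_le 0 j (by omega) hj (by simp) he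
    linarith
  have odd_ge : ∀ j, j < 2 * t → ¬ Even j → x (2 * t - 1) ≤ x j := fun j hj he =>
    anti_le j _ (by omega) (by omega) he hlast
  have even_lt : ∀ j, j < 2 * t → Even j → x j < x (2 * t - 1) := fun j hj he =>
    (mono_le j _ (by rw [Nat.even_iff] at he; omega) (by omega) he hlast').trans_lt hmid
  have odd_lo : ∀ j i, j + 1 < 2 * t → i < lam → Even j → ¬ S (j + 1) i →
      x j < x (j + 1) - η (j + 1) i := by
    intro j i hj hi he hs
    have := hηδ j i hj hi hs
    have := hxe j hj he
    linarith
  have odd_hi : ∀ j i, j + 1 < 2 * t → i < lam → ¬ Even j → ¬ S j i →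
      x j - η j i < x (j + 1) := by
    intro j i hj hi he hs
    have := hδη j i hj hi hs
    have := hxo j hj he
    linarith
  have even_hi : ∀ j i, j + 1 < 2 * t → i < lam → ¬ Even j → ¬ S (j + 1) i →
      x (j + 1) + η (j + 1) i < x j := by
    intro j i hj hi he hs
    have := hηδ j i hj hi hs
    have := hxo j hj he
    linarith
  have even_lo : ∀ j i, j + 1 < 2 * t → i < lam → Even j → ¬ S j i →
      x (j + 1) < x j + η j i := by
    intro j i hj hi he hs
    have := hδη j i hj hi hs
    have := hxe j hj he
    linarith
  have hSe : ∀ j i, j < 2 * t → i < lam → Even j → ¬ S j i := fun j i hj hi he hs =>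
    (hS j i hj hi hs).1 he
  let Sp : Fin (2 * t) ⊕ Fin (2 * t) × Fin lam → Prop :=
    Sum.elim (fun _ => False) (fun p => S p.1 p.2)
  let f : Fin (2 * t) ⊕ Fin (2 * t) × Fin lam → ℤ := hairyLabel x η
  have hSneg : ∀ u, Sp u → u ∈ lowerClass t lam ∧ -T < f u ∧ f u < 0 := by
    rintro (j | ⟨j, i⟩) hs
    · exact hs.elim
    · obtain ⟨h1, h2⟩ := hS j i j.2 i.2 hs
      have h3 := odd_ge j j.2 h1
      have h4 := even_nonneg _ (by omega) hlast'
      have h5 := hηlt j i j.2 i.2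
      refine ⟨h1, ?_⟩
      simp only [f, hairyLabel, h1, if_false]
      constructor <;> linarith
  have hA : ∀ u ∈ lowerClass t lam, ¬ Sp u → 0 ≤ f u ∧ f u < x (2 * t - 1) := by
    rintro (⟨j, hj⟩ | ⟨⟨j, hj⟩, i, hi⟩) hu hs
    · exact ⟨even_nonneg j hj hu, even_lt j hj hu⟩
    · change ¬ Even j at hu
      change ¬ S j i at hs
      simp only [f, hairyLabel, hu, if_false]
      constructor
      · obtain ⟨a, rfl⟩ : ∃ a, j = a + 1 := ⟨j - 1, by rw [Nat.even_iff] at hu; omega⟩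
        have ha : Even a := by simpa [Nat.even_add_one] using hu
        exact (even_nonneg a (by omega) ha).trans (odd_lo a i hj hi ha hs).le
      · rcases Nat.lt_or_ge (j + 1) (2 * t) with h | h
        · exact (odd_hi j i h hi hu hs).trans
            (even_lt (j + 1) h (by simpa [Nat.even_add_one] using hu))
        · obtain rfl : j = 2 * t - 1 := by omega
          linarith [hηpos _ i hj hi]
  have hB : ∀ u ∉ lowerClass t lam, x (2 * t - 1) ≤ f u ∧ f u < T := by
    have h1T : ∀ j, j < 2 * t → ¬ Even j → x j < T := by
      intro j hj he
      have h1 := anti_le 1 j (by rw [Nat.even_iff] at he; omega) hj (by simp) he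
      have h2 := hxe 0 (by omega) (by simp)
      have h3 := hδlt 0 (by omega)
      rw [zero_add] at h2
      linarith
    rintro (⟨j, hj⟩ | ⟨⟨j, hj⟩, i, hi⟩) hu
    · exact ⟨odd_ge j hj hu, h1T j hj hu⟩
    · replace hu : Even j := not_not.1 hu
      have hs := hSe j i hj hi hu
      have hj' : j + 1 < 2 * t := by rw [Nat.even_iff] at hu; omega
      simp only [f, hairyLabel, hu, if_true]
      constructor
      · exact (odd_ge (j + 1) hj' (by simpa [Nat.even_add_one] using hu)).trans
          (even_lo j i hj' hi hu hs).le
      · rcases Nat.eq_zero_or_pos j with rfl | h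
        · linarith [hηlt 0 i hj hi]
        · obtain ⟨a, rfl⟩ : ∃ a, j = a + 1 := ⟨j - 1, by omega⟩
          have ha : ¬ Even a := by simpa [Nat.even_add_one] using hu
          exact (even_hi a i hj hi ha hs).trans (h1T a (by omega) ha)
  have hlastpos : 0 < x (2 * t - 1) := (even_nonneg _ (by omega) hlast').trans_lt hmid
  have lower_lt : ∀ u v, u ∈ lowerClass t lam → v ∈ lowerClass t lam → ¬ Sp u → ¬ Sp v →
      hairyPos u < hairyPos v → f u < f v := by
    rintro (⟨j, hj⟩ | ⟨⟨j, hj⟩, i, hi⟩) (⟨j', hj'⟩ | ⟨⟨j', hj'⟩, i', hi'⟩) hu hv hsu hsv hlt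
    · exact mono_lt j j' hlt hj' hu hv
    · change Even j at hu; change ¬ Even j' at hv; change ¬ S j' i' at hsv; change j < j' at hlt
      obtain ⟨a, rfl⟩ : ∃ a, j' = a + 1 := ⟨j' - 1, by omega⟩
      have ha : Even a := by simpa [Nat.even_add_one] using hv
      simp only [f, hairyLabel, hv, if_false]
      exact (mono_le j a (by omega) (by omega) hu ha).trans_lt (odd_lo a i' hj' hi' ha hsv)
    · change ¬ Even j at hu; change Even j' at hv; change ¬ S j i at hsu; change j < j' at hlt
      simp only [f, hairyLabel, hu, if_false]
      exact (odd_hi j i (by omega) hi hu hsu).trans_le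
        (mono_le (j + 1) j' (by omega) hj' (by simpa [Nat.even_add_one] using hu) hv)
    · change ¬ Even j at hu; change ¬ Even j' at hv; change ¬ S j i at hsu
      change ¬ S j' i' at hsv; change j < j' at hlt
      obtain ⟨a, rfl⟩ : ∃ a, j' = a + 1 := ⟨j' - 1, by omega⟩
      have ha : Even a := by simpa [Nat.even_add_one] using hv
      simp only [f, hairyLabel, hu, hv, if_false]
      refine (odd_hi j i (by omega) hi hu hsu).trans_le (le_trans ?_ (odd_lo a i' hj' hi' ha hsv).le)
      exact mono_le (j + 1) a (by rw [Nat.even_iff] at hu ha; omega) (by omega)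
        (by simpa [Nat.even_add_one] using hu) ha
  have upper_lt : ∀ u v, u ∉ lowerClass t lam → v ∉ lowerClass t lam →
      hairyPos u < hairyPos v → f v < f u := by
    rintro (⟨j, hj⟩ | ⟨⟨j, hj⟩, i, hi⟩) (⟨j', hj'⟩ | ⟨⟨j', hj'⟩, i', hi'⟩) hu hv hlt
    · exact anti_lt j j' hlt hj' hu hv
    · change ¬ Even j at hu; replace hv : Even j' := not_not.1 hv; change j < j' at hlt
      have hsv := hSe j' i' hj' hi' hv
      obtain ⟨a, rfl⟩ : ∃ a, j' = a + 1 := ⟨j' - 1, by omega⟩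
      have ha : ¬ Even a := by simpa [Nat.even_add_one] using hv
      simp only [f, hairyLabel, hv, if_true]
      exact (even_hi a i' hj' hi' ha hsv).trans_le (anti_le j a (by omega) (by omega) hu ha)
    · replace hu : Even j := not_not.1 hu; change ¬ Even j' at hv; change j < j' at hlt
      have hsu := hSe j i hj hi hu
      simp only [f, hairyLabel, hu, if_true]
      exact (anti_le (j + 1) j' (by omega) hj'
        (by simpa [Nat.even_add_one] using hu) hv).trans_lt (even_lo j i (by omega) hi hu hsu)
    · replace hu : Even j := not_not.1 hu; replace hv : Even j' := not_not.1 hv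
      change j < j' at hlt
      have hsu := hSe j i hj hi hu
      have hsv := hSe j' i' hj' hi' hv
      obtain ⟨a, rfl⟩ : ∃ a, j' = a + 1 := ⟨j' - 1, by omega⟩
      have ha : ¬ Even a := by simpa [Nat.even_add_one] using hv
      simp only [f, hairyLabel, hu, hv, if_true]
      refine (even_hi a i' hj' hi' ha hsv).trans_le (le_trans ?_ (even_lo j i (by omega) hi hu hsu).le)
      exact anti_le (j + 1) a (by rw [Nat.even_iff] at hu ha; omega) (by omega)
        (by simpa [Nat.even_add_one] using hu) ha
  have same_pos : ∀ u v, (u ∈ lowerClass t lam ↔ v ∈ lowerClass t lam) →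
      hairyPos u = hairyPos v → f u = f v → u = v := by
    rintro (j | ⟨j, i⟩) (j' | ⟨j', i'⟩) huv hpos h
    · exact congrArg Sum.inl (Fin.ext hpos)
    · obtain rfl : j = j' := Fin.ext hpos
      change Even (j : ℕ) ↔ ¬ Even (j : ℕ) at huv
      tauto
    · obtain rfl : j = j' := Fin.ext hpos
      change ¬ Even (j : ℕ) ↔ Even (j : ℕ) at huv
      tauto
    · obtain rfl : j = j' := Fin.ext hpos
      have : η j i = η j i' := by
        simp only [f, hairyLabel] at h
        split_ifs at h <;> linarith
      exact hinj (a₁ := Sum.inr (j, i)) (a₂ := Sum.inr (j, i')) this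
  have hfinj : Function.Injective f := by
    intro u v h
    by_cases hu : u ∈ lowerClass t lam <;> by_cases hv : v ∈ lowerClass t lam
    · refine same_pos u v (by tauto) ?_ h
      by_cases hsu : Sp u <;> by_cases hsv : Sp v
      · rcases u with j | ⟨j, i⟩ <;> rcases v with j' | ⟨j', i'⟩
        · exact hsu.elim
        · exact hsu.elim
        · exact hsv.elim
        · exact hSu _ _ _ _ hsu hsv
      · linarith [(hSneg u hsu).2.2, (hA v hv hsv).1]
      · linarith [(hSneg v hsv).2.2, (hA u hu hsu).1]
      · rcases lt_trichotomy (hairyPos u) (hairyPos v) with hp | hp | hp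
        · linarith [lower_lt u v hu hv hsu hsv hp]
        · exact hp
        · linarith [lower_lt v u hv hu hsv hsu hp]
    · by_cases hsu : Sp u
      · linarith [(hSneg u hsu).2.2, (hB v hv).1]
      · linarith [(hA u hu hsu).2, (hB v hv).1]
    · by_cases hsv : Sp v
      · linarith [(hSneg v hsv).2.2, (hB u hu).1]
      · linarith [(hA v hv hsv).2, (hB u hu).1]
    · refine same_pos u v (by tauto) ?_ h
      rcases lt_trichotomy (hairyPos u) (hairyPos v) with hp | hp | hp
      · linarith [upper_lt u v hu hv hp]
      · exact hp
      · linarith [upper_lt v u hv hu hp]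
  have hA' : ∀ u ∈ lowerClass t lam, -T < f u ∧ f u < x (2 * t - 1) := by
    intro u hu
    by_cases hs : Sp u
    · exact ⟨(hSneg u hs).2.1, (hSneg u hs).2.2.trans hlastpos⟩
    · exact ⟨by linarith [(hA u hu hs).1], (hA u hu hs).2⟩
  have hw : ∀ e : HairyEdge t lam, f (upperEnd e) - f (lowerEnd e) =
      edgeValue δ η e := by
    rintro (⟨j, hj⟩ | ⟨⟨j, hj⟩, i, hi⟩)
    · by_cases h : j + 1 < 2 * t
      · by_cases he : Even j
        · simp [edgeValue, f, upperEnd, lowerEnd, he, hairyLabel, cycleSucc, h, hxe j h he]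
        · simp [edgeValue, f, upperEnd, lowerEnd, he, hairyLabel, cycleSucc, h, hxo j h he]
      · obtain rfl : j = 2 * t - 1 := by omega
        simp [edgeValue, f, upperEnd, lowerEnd, hlast, hairyLabel, cycleSucc, h, hx0, hclose]
    · by_cases he : Even j <;> simp [edgeValue, f, upperEnd, lowerEnd, he, hairyLabel]
  refine exists_cyclic_decomposition_of_alpha_labeling (hairyCycle t lam) d r n hd hr hn
    (lowerClass t lam) lowerEnd upperEnd lowerEnd_mem upperEnd_notMem (hairyCycle_adj_iff ht) f
    hfinj ?_ ?_ ?_ ?_ ?_ ?_ ?_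
  · intro u
    by_cases hu : u ∈ lowerClass t lam
    · exact (hA' u hu).1
    · linarith [(hB u hu).1]
  · intro u
    by_cases hu : u ∈ lowerClass t lam
    · have := (hA' u hu).2
      rw [hclose] at this
      exact this.trans (hδlt _ (by omega))
    · exact (hB u hu).2
  · exact fun u v hu hv => (hA' u hu).2.trans_le (hB v hv).1
  · intro e e' h
    rw [hw, hw] at h
    exact hinj h
  · intro e
    rw [hw]
    rcases e with j | p
    · exact hδlt j j.2
    · exact hηlt p.1 p.2 p.1.2 p.2.2
  · intro e
    rw [hw]
    exact hdvd e
  · simpa only [hw] using hsurj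

/-! ### The decreasing list of non-multiples. -/

/-- The `i`-th largest (counted from `0`) non-multiple of `m + 1` below `d * (m + 1)`. -/
def nonMultiple (d m i : ℕ) : ℤ := ((d * (m + 1) : ℕ) : ℤ) - 1 - i - (i / m : ℕ)

theorem nonMultiple_strictAnti (d m : ℕ) : StrictAnti (nonMultiple d m) := by
  intro i j h
  have := Nat.div_le_div_right (c := m) h.le
  simp only [nonMultiple]
  omega

/-- A multiple of `m + 1` is skipped after every `m` entries, and only there is the gap 2. -/
theorem nonMultiple_sub_succ (d m i : ℕ) :
    nonMultiple d m i - nonMultiple d m (i + 1) = 1 + if m ∣ i + 1 then 1 else 0 := by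
  simp only [nonMultiple, Nat.succ_div]
  split_ifs <;> push_cast <;> ring

/-- Subtraction from `d * (m + 1)` permutes the non-multiples in the range and reverses their order.
-/
theorem nonMultiple_reflect {d m : ℕ} (hm : 0 < m) {i j : ℕ} (h : i + j + 1 = d * m) :
    nonMultiple d m i + nonMultiple d m j = (d * (m + 1) : ℕ) := by
  have h1 := Nat.div_add_mod i m
  have h2 := Nat.div_add_mod j m
  have h3 := Nat.mod_lt i hm
  have h4 := Nat.mod_lt j hm
  have h5 : i / m + j / m + 1 = d := by
    have h0 := mul_comm d m
    have e1 : m * (i / m + j / m + 1) < m * (d + 1) := by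
      simp only [mul_add, mul_one]; omega
    have e2 : m * d < m * (i / m + j / m + 1 + 1) := by
      simp only [mul_add, mul_one]; omega
    have := Nat.lt_of_mul_lt_mul_left e1
    have := Nat.lt_of_mul_lt_mul_left e2
    omega
  have h6 : (((d * (m + 1) : ℕ)) : ℤ) = i + j + 1 + d := by rw [mul_add, ← h]; push_cast; ring
  simp only [nonMultiple]
  omega

theorem nonMultiple_lt (d m i : ℕ) : nonMultiple d m i < (d * (m + 1) : ℕ) := by
  have h1 : (0 : ℤ) ≤ ((i / m : ℕ) : ℤ) := Int.natCast_nonneg _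
  have h2 : (0 : ℤ) ≤ i := Int.natCast_nonneg _
  simp only [nonMultiple]
  linarith

theorem nonMultiple_pos {d m i : ℕ} (hi : i < d * m) : 0 < nonMultiple d m i := by
  have hm : 0 < m := Nat.pos_of_ne_zero fun h => by simp [h] at hi
  have h := nonMultiple_reflect (d := d) hm (i := i) (j := d * m - 1 - i) (by omega)
  have := nonMultiple_lt d m (d * m - 1 - i)
  omega

theorem not_dvd_nonMultiple {d m : ℕ} (hm : 0 < m) (i : ℕ) :
    ¬ ((m + 1 : ℕ) : ℤ) ∣ nonMultiple d m i := by
  intro h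
  have h1 := Nat.div_add_mod i m
  have h3 := Nat.mod_lt i hm
  have h2 : nonMultiple d m i = ((m + 1 : ℕ) : ℤ) * (d - (i / m : ℕ)) - (1 + (i % m : ℕ) : ℕ) := by
    have : (i : ℤ) = m * (i / m : ℕ) + (i % m : ℕ) := by exact_mod_cast h1.symm
    simp only [nonMultiple]
    conv_lhs => rw [this]
    push_cast
    ring
  rw [h2, dvd_sub_right (Dvd.intro _ rfl), Int.natCast_dvd_natCast] at h
  have := Nat.le_of_dvd (by omega) h
  omega

/-- Count down from the top, `y = (m + 1) * q + b`: the remainder `b = m` occurs only at multiples,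
and otherwise the rank is `m * q + b`. -/
theorem exists_nonMultiple_eq {d m : ℕ} {z : ℤ} (hz : 0 < z)
    (hz' : z < (d * (m + 1) : ℕ)) (h : ¬ ((m + 1 : ℕ) : ℤ) ∣ z) :
    ∃ i < d * m, nonMultiple d m i = z := by
  obtain ⟨y, hy⟩ : ∃ y : ℕ, (y : ℤ) = (d * (m + 1) : ℕ) - 1 - z :=
    ⟨((d * (m + 1) : ℕ) - 1 - z).toNat, by omega⟩
  have h1 := Nat.div_add_mod y (m + 1)
  have h2 := Nat.mod_lt y (Nat.succ_pos m)
  set q := y / (m + 1)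
  set b := y % (m + 1)
  have hb : b ≠ m := by
    intro hb
    apply h
    refine ⟨d - 1 - q, ?_⟩
    have : (y : ℤ) = (m + 1) * q + m := by rw [← h1, hb]; push_cast; ring
    rw [this] at hy
    push_cast at hy ⊢
    linarith
  have hbm : b < m := by omega
  have hq : q < d := by
    have : (m + 1) * q < (m + 1) * d := by rw [mul_comm (m + 1) d]; omega
    exact Nat.lt_of_mul_lt_mul_left this
  refine ⟨m * q + b, ?_, ?_⟩
  · have := Nat.mul_le_mul_left m (show q + 1 ≤ d from hq)
    nlinarith
  · have : (m * q + b) / m = q := by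
      rw [Nat.mul_add_div (by omega), Nat.div_eq_of_lt hbm, add_zero]
    simp only [nonMultiple, this]
    have : (y : ℤ) = (m + 1) * q + b := by rw [← h1]; push_cast; ring
    push_cast at *
    linarith

/-! ### Labellings prescribed by ranks. -/

/-- The alternating sum of the first `j` terms of `D ∘ ρ`. -/
def zigzag (D : ℕ → ℤ) (ρ : ℕ → ℕ) (j : ℕ) : ℤ := ∑ l ∈ Finset.range j, (-1) ^ l * D (ρ l)

/-- A zigzag labelling given by the ranks `ρ` and `κ` of the differences of the cycle edges and of
the hairs among the non-multiples of `m + 1`. -/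
theorem exists_cyclic_decomposition_of_ranks (t lam d m n : ℕ) (ht : 1 ≤ t)
    (hd : 0 < d) (hm : 0 < m) (hn : 0 < n) (hdm : 2 * t * (lam + 1) = d * m)
    (ρ : ℕ → ℕ) (κ : ℕ → ℕ → ℕ) (S : ℕ → ℕ → Prop)
    (hclose : zigzag (nonMultiple d m) ρ (2 * t - 1) = nonMultiple d m (ρ (2 * t - 1)))
    (hmono : ∀ j, j + 2 < 2 * t → ρ j < ρ (j + 1))
    (hκρ : ∀ j i, j + 1 < 2 * t → i < lam → ¬ S j i → κ j i < ρ j)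
    (hρκ : ∀ j i, j + 1 < 2 * t → i < lam → ¬ S (j + 1) i → ρ j < κ (j + 1) i)
    (hS : ∀ j i, j < 2 * t → i < lam → S j i →
      ¬ Even j ∧ zigzag (nonMultiple d m) ρ j < nonMultiple d m (κ j i))
    (hSu : ∀ j i j' i', S j i → S j' i' → j = j')
    (hlt : ∀ e : HairyEdge t lam, edgeValue ρ κ e < d * m)
    (hinj : Function.Injective (edgeValue ρ κ : HairyEdge t lam → ℕ)) :
    ∃ B : Set (SimpleGraph.completeEquipartiteGraph (m + 1) (2 * d * n)).Subgraph,
      IsDecomposition (hairyCycle t lam)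
        (SimpleGraph.completeEquipartiteGraph (m + 1) (2 * d * n)) B ∧
      IsCyclicFamily (SimpleGraph.completeEquipartiteGraph (m + 1) (2 * d * n)) B := by
  have hD := nonMultiple_strictAnti d m
  have hval : ∀ e : HairyEdge t lam, edgeValue (fun j => nonMultiple d m (ρ j))
      (fun j i => nonMultiple d m (κ j i)) e = nonMultiple d m (edgeValue ρ κ e) := by
    rintro (j | p) <;> rfl
  have hρlt : ∀ j, j < 2 * t → ρ j < d * m := fun j hj => hlt (.inl ⟨j, hj⟩)
  have hκlt : ∀ j i, j < 2 * t → i < lam → κ j i < d * m := fun j i hj hi =>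
    hlt (.inr (⟨j, hj⟩, ⟨i, hi⟩))
  -- There are as many edges as ranks, so an injective assignment is onto.
  have hsurj : ∀ i < d * m, ∃ e : HairyEdge t lam, edgeValue ρ κ e = i := by
    let g : HairyEdge t lam → Fin (d * m) := fun e => ⟨edgeValue ρ κ e, hlt e⟩
    have hg : Function.Bijective g := by
      rw [Fintype.bijective_iff_injective_and_card]
      refine ⟨fun e e' h => hinj (Fin.ext_iff.1 h), ?_⟩
      simp [← hdm]; ring
    intro i hi
    obtain ⟨e, he⟩ := hg.2 ⟨i, hi⟩
    exact ⟨e, Fin.ext_iff.1 he⟩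
  refine exists_cyclic_decomposition_of_zigzag t lam d (m + 1) n ht hd (Nat.succ_pos m) hn
    (zigzag (nonMultiple d m) ρ) (fun j => nonMultiple d m (ρ j))
    (fun j i => nonMultiple d m (κ j i)) S ?_ ?_ ?_ hclose ?_ ?_ ?_ hS hSu ?_ ?_ ?_ ?_ ?_ ?_ ?_
  · simp [zigzag]
  · intro j _ he
    simp [zigzag, Finset.sum_range_succ, he.neg_one_pow]
  · intro j _ he
    rw [Nat.not_even_iff_odd] at he
    simp [zigzag, Finset.sum_range_succ, he.neg_one_pow]
    ring
  · exact fun j hj => hD (hmono j hj)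
  · exact fun j i hj hi hs => hD (hκρ j i hj hi hs)
  · exact fun j i hj hi hs => hD (hρκ j i hj hi hs)
  · exact fun j hj => nonMultiple_pos (hρlt j hj)
  · exact fun j _ => nonMultiple_lt _ _ _
  · exact fun j i hj hi => nonMultiple_pos (hκlt j i hj hi)
  · exact fun j i _ _ => nonMultiple_lt _ _ _
  · intro e e' h
    rw [hval, hval] at h
    exact hinj (hD.injective h)
  · intro e
    rw [hval]
    exact not_dvd_nonMultiple hm _
  · intro z hz hz' hdvd
    obtain ⟨i, hi, rfl⟩ := exists_nonMultiple_eq hz hz' hdvd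
    obtain ⟨e, rfl⟩ := hsurj i hi
    exact ⟨e, hval e⟩

theorem nonMultiple_add_le (d m : ℕ) {a b : ℕ} (h : a ≤ b) :
    nonMultiple d m b + (b - a : ℕ) ≤ nonMultiple d m a := by
  have := Nat.div_le_div_right (c := m) h
  simp only [nonMultiple]
  omega

theorem zigzag_add_two (D : ℕ → ℤ) (ρ : ℕ → ℕ) {j : ℕ} (hj : Odd j) :
    zigzag D ρ (j + 2) = zigzag D ρ j - D (ρ j) + D (ρ (j + 1)) := by
  simp only [zigzag, Finset.sum_range_succ, hj.neg_one_pow, (hj.add_one).neg_one_pow]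
  ring

/-- Each double step adds `D (ρ (j + 1)) - D (ρ j) ≤ 0`. This reduces negativity of the exceptional
hair's label to a check at a small odd index. -/
theorem zigzag_odd_le {D : ℕ → ℤ} (hD : Antitone D) {ρ : ℕ → ℕ} {a b : ℕ}
    (hρ : ∀ j < b, ρ j ≤ ρ (j + 1)) (ha : Odd a) (hb : Odd b) (hab : a ≤ b) :
    zigzag D ρ b ≤ zigzag D ρ a := by
  obtain ⟨c, rfl⟩ : ∃ c, b = a + 2 * c := ⟨(b - a) / 2, by
    rw [Nat.odd_iff] at ha hb; omega⟩
  clear hb hab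
  induction c with
  | zero => simp
  | succ c ih =>
    have h1 := ih fun j hj => hρ j (by omega)
    have h2 := hD (hρ (a + 2 * c) (by omega))
    rw [show a + 2 * (c + 1) = a + 2 * c + 2 by ring,
      zigzag_add_two _ _ (ha.add_even (even_two_mul c))]
    linarith

/-- The alternating sum along the path obtained by deleting the closing edge, with the edges paired
symmetrically about the middle one. -/
theorem zigzag_symm {d m k u : ℕ} (hk : 0 < k) (hm : 0 < m) (h : 2 * (u + 1) * k = d * m)
    (ρ : ℕ → ℕ) (hρ : ∀ j, u < j → j ≤ 2 * u → ρ j = (j + 1) * k) :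
    zigzag (nonMultiple d m) ρ (2 * u + 1) =
      ∑ j ∈ Finset.range u, (-1) ^ j * ((d * (m + 1) : ℕ) -
        (nonMultiple d m ((j + 1) * k - 1) - nonMultiple d m (ρ j))) +
      (-1) ^ u * nonMultiple d m (ρ u) := by
  -- Edge `2 * u - j` has the same sign as edge `j`, and its rank is the reflection of `(j + 1) * k
  -- - 1`.
  have key : ∑ x ∈ Finset.range u, (-1) ^ (u + (x + 1)) * nonMultiple d m (ρ (u + (x + 1))) =
      ∑ j ∈ Finset.range u, (-1) ^ j *
        (((d * (m + 1) : ℕ) : ℤ) - nonMultiple d m ((j + 1) * k - 1)) := by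
    rw [← Finset.sum_range_reflect]
    refine Finset.sum_congr rfl fun j hj => ?_
    rw [Finset.mem_range] at hj
    obtain ⟨c, rfl⟩ : ∃ c, u = j + c + 1 := ⟨u - 1 - j, by omega⟩
    have e1 : j + c + 1 + (j + c + 1 - 1 - j + 1) = j + 2 * (c + 1) := by omega
    rw [e1, pow_add, pow_mul, hρ _ (by omega) (by omega)]
    have h1 : 0 < (j + 1) * k := by positivity
    have h2 : (j + 2 * (c + 1) + 1) * k + ((j + 1) * k - 1) + 1 = d * m := by
      rw [add_assoc, Nat.sub_add_cancel h1, ← h]; ring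
    rw [← nonMultiple_reflect hm h2]
    simp
  rw [zigzag, show 2 * u + 1 = u + (u + 1) by ring, Finset.sum_range_add, Finset.sum_range_succ',
    key, add_zero, ← add_assoc, ← Finset.sum_add_distrib]
  congr 1
  refine Finset.sum_congr rfl fun j _ => ?_
  ring

theorem sum_neg_one_pow_mul_const (u : ℕ) (c : ℤ) :
    ∑ j ∈ Finset.range u, (-1) ^ j * c = if Even u then 0 else c := by
  rw [← Finset.sum_mul, neg_one_geom_sum]
  split_ifs <;> simp

/-! ### The two rank assignments. -/

/-- The decomposition when `t` is even (`R = 0`), or `t` is odd and a multiple of `m` of the form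
`R * k` detects whether `m ∣ t * k`. -/
theorem exists_cyclic_decomposition_of_shift (t lam d m n R : ℕ) (ht : 2 ≤ t) (hlam : 1 ≤ lam)
    (hd : 0 < d) (hm : 0 < m) (hn : 0 < n) (hdm : 2 * t * (lam + 1) = d * m)
    (hR : (Even t ∧ R = 0) ∨ (Odd t ∧ Odd R ∧ R < t ∧
      (∀ j, 0 < j → j < R → ¬ m ∣ j * (lam + 1)) ∧ (m ∣ R * (lam + 1) ↔ m ∣ t * (lam + 1)))) :
    ∃ B : Set (SimpleGraph.completeEquipartiteGraph (m + 1) (2 * d * n)).Subgraph,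
      IsDecomposition (hairyCycle t lam)
        (SimpleGraph.completeEquipartiteGraph (m + 1) (2 * d * n)) B ∧
      IsCyclicFamily (SimpleGraph.completeEquipartiteGraph (m + 1) (2 * d * n)) B := by
  obtain ⟨k, hk⟩ : ∃ k, k = lam + 1 := ⟨_, rfl⟩
  rw [← hk] at hdm hR
  have hRt : R < t := by rcases hR with ⟨-, h⟩ | ⟨-, -, h, -⟩ <;> omega
  have hkk : ∀ a b, a < b → a * k + k ≤ b * k := fun a b h => by
    have := Nat.mul_le_mul_right k (show a + 1 ≤ b from h)
    rwa [add_mul, one_mul] at this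
  have hke : ∀ a b, a = b → a * k = b * k := fun a b h => by rw [h]
  have hdm' : d * m = t * k + t * k := by rw [← hdm]; ring
  -- Block `j` holds ranks from `j * k` on, and blocks from `t` on move up by one to leave rank `t *
  -- k` to the closing edge. For `R > 0`, hair 0 at `R` takes rank 0, and the blocks before `R` move
  -- up by one into the hole it leaves at `R * k`.
  let ρ : ℕ → ℕ := fun j => if j = 2 * t - 1 then t * k else
    if R ≤ j ∧ j < t then j * k + k - 1 else j * k + k
  let κ : ℕ → ℕ → ℕ := fun j i => if j = R then (if i = 0 then 0 else R * k + i) else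
    if R < j ∧ j < t then j * k + i else j * k + 1 + i
  have hD := nonMultiple_strictAnti d m
  refine exists_cyclic_decomposition_of_ranks t lam d m n (by omega) hd hm hn (by rw [← hk, hdm])
    ρ κ (fun j i => Odd R ∧ j = R ∧ i = 0) ?_ ?_ ?_ ?_ ?_ ?_ ?_ ?_
  · obtain ⟨u, rfl⟩ : ∃ u, t = u + 1 := ⟨t - 1, by omega⟩
    have hρ : ∀ j, u < j → j ≤ 2 * u → ρ j = (j + 1) * k := by
      intro j h1 h2
      simp only [ρ, add_mul, one_mul]
      split_ifs <;> omega
    have hρu : ρ u = (u + 1) * k - 1 := by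
      simp only [ρ, add_mul, one_mul]
      split_ifs <;> omega
    have hρlast : ρ (2 * (u + 1) - 1) = (u + 1) * k := by simp [ρ]
    have hterm : ∀ j, nonMultiple d m ((j + 1) * k - 1) - nonMultiple d m ((j + 1) * k) =
        1 + if m ∣ (j + 1) * k then 1 else 0 := by
      intro j
      have h1 : (j + 1) * k - 1 + 1 = (j + 1) * k :=
        Nat.sub_add_cancel (Nat.mul_pos j.succ_pos (by omega))
      have := nonMultiple_sub_succ d m ((j + 1) * k - 1)
      rwa [h1] at this
    have hsum : ∑ j ∈ Finset.range u, (-1) ^ j * (((d * (m + 1) : ℕ) : ℤ) -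
        (nonMultiple d m ((j + 1) * k - 1) - nonMultiple d m (ρ j))) =
        (if Even u then 0 else ((d * (m + 1) : ℕ) : ℤ)) -
        ∑ j ∈ Finset.range R, (-1) ^ j * (1 + if m ∣ (j + 1) * k then 1 else 0) := by
      rw [← sum_neg_one_pow_mul_const]
      have h1 : ∑ j ∈ Finset.range R, (-1 : ℤ) ^ j * (1 + if m ∣ (j + 1) * k then 1 else 0) =
          ∑ j ∈ Finset.range u, (-1) ^ j *
            (nonMultiple d m ((j + 1) * k - 1) - nonMultiple d m (ρ j)) := by
        rw [← Finset.sum_subset (Finset.range_subset_range.2 (show R ≤ u by omega))]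
        · refine Finset.sum_congr rfl fun j hj => ?_
          rw [Finset.mem_range] at hj
          have : ρ j = (j + 1) * k := by
            simp only [ρ, add_mul, one_mul]
            split_ifs <;> omega
          rw [this, hterm]
        · intro j hj hj'
          rw [Finset.mem_range] at hj hj'
          have : ρ j = (j + 1) * k - 1 := by
            simp only [ρ, add_mul, one_mul]
            split_ifs <;> omega
          rw [this]; ring
      rw [h1, ← Finset.sum_sub_distrib]
      exact Finset.sum_congr rfl fun j _ => by ring
    rw [show 2 * (u + 1) - 1 = 2 * u + 1 by omega] at hρlast ⊢
    rw [zigzag_symm (by omega) hm hdm ρ hρ, hsum, hρlast, hρu]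
    rcases hR with ⟨h1, rfl⟩ | ⟨h1, h2, -, h3, h4⟩
    · have hu : Odd u := by rw [Nat.even_add_one] at h1; exact Nat.not_even_iff_odd.1 h1
      have h5 : (u + 1) * k - 1 + (u + 1) * k + 1 = d * m := by
        have : 0 < (u + 1) * k := Nat.mul_pos u.succ_pos (by omega)
        omega
      have := nonMultiple_reflect hm h5
      simp [hu.neg_one_pow, Nat.not_even_iff_odd.2 hu]
      push_cast at this
      linarith
    · have hu : Even u := by
        rw [← Nat.not_even_iff_odd, Nat.even_add_one, not_not] at h1; exact h1
      have h5 := hterm u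
      obtain ⟨v, rfl⟩ : ∃ v, R = v + 1 := ⟨R - 1, by have := h2.pos; omega⟩
      have hv : Even v := by
        rw [← Nat.not_even_iff_odd, Nat.even_add_one, not_not] at h2; exact h2
      -- Before `R` all gaps are 1 and cancel in pairs; the last one, at `R * k`, equals the gap at
      -- `t * k` by `h4`.
      have h6 : ∑ j ∈ Finset.range v, (-1 : ℤ) ^ j * (1 + if m ∣ (j + 1) * k then 1 else 0) = 0 := by
        have h7 := sum_neg_one_pow_mul_const v 1
        rw [if_pos hv] at h7
        refine (Finset.sum_congr rfl fun j hj => ?_).trans h7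
        rw [Finset.mem_range] at hj
        rw [if_neg (h3 _ (by omega) (by omega)), add_zero]
      rw [Finset.sum_range_succ, h6, hv.neg_one_pow, hu.neg_one_pow, if_pos hu]
      simp only [h4]
      linarith
  · intro j hj
    have := hkk j (j + 1) (by omega)
    simp only [ρ]
    split_ifs <;> omega
  · intro j i hj hi hs
    have := hkk R t hRt
    simp only [ρ, κ]
    split_ifs <;> subst_vars <;> omega
  · intro j i hj hi hs
    have e : (j + 1) * k = j * k + k := by ring
    have hs' : ¬ (j + 1 = R ∧ i = 0) := fun ⟨h, h'⟩ => by
      rcases hR with ⟨-, h0⟩ | ⟨-, h0, -⟩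
      · omega
      · exact hs ⟨h0, h, h'⟩
    have e' : j + 1 = R → R * k = j * k + k := fun h => by rw [← h, e]
    simp only [ρ, κ, e]
    split_ifs <;> omega
  · rintro j i hj hi ⟨hRo, rfl, rfl⟩
    refine ⟨Nat.not_even_iff_odd.2 hRo, ?_⟩
    -- The first path label is `D (ρ 0)`, already below the largest difference, that of rank 0.
    have h1 : zigzag (nonMultiple d m) ρ j ≤ zigzag (nonMultiple d m) ρ 1 := by
      refine zigzag_odd_le hD.antitone (fun l hl => ?_) odd_one hRo hRo.pos
      have := hkk l (l + 1) (by omega)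
      simp only [ρ]
      split_ifs <;> omega
    refine h1.trans_lt ?_
    have h2 : κ j 0 < ρ 0 := by
      have := hRo.pos
      simp only [ρ, κ]
      split_ifs <;> omega
    simpa [zigzag] using hD h2
  · rintro j i j' i' ⟨-, h, -⟩ ⟨-, h', -⟩
    rw [h, h']
  · have hR0 := hkk R t hRt
    rintro (⟨j, hj⟩ | ⟨⟨j, hj⟩, i, hi⟩) <;> simp only [edgeValue, hdm', ρ, κ]
    · have := hkk j (2 * t - 1)
      have := hkk j t
      have e : (2 * t - 1) * k = t * k + t * k - k := by rw [Nat.sub_mul, one_mul]; ring_nf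
      split_ifs <;> omega
    · have := hkk j (2 * t) hj
      have e : 2 * t * k = t * k + t * k := by ring
      split_ifs <;> omega
  · have hκb : ∀ j i, i < lam → ¬ (j = R ∧ i = 0) → j * k ≤ κ j i ∧ κ j i < j * k + k := by
      intro j i hi hs
      have := hke j R
      simp only [κ]
      split_ifs <;> omega
    have hκR : κ R 0 = 0 := by simp [κ]
    have hκ0 : ∀ j i, ¬ (j = R ∧ i = 0) → 0 < κ j i := by
      intro j i hs
      have := hkk 0 j
      simp only [κ]
      split_ifs <;> omega
    have hne : ∀ j j' i', j < 2 * t → i' < lam → ρ j ≠ κ j' i' := by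
      intro j j' i' hj hi'
      by_cases hs : j' = R ∧ i' = 0
      · rw [hs.1, hs.2, hκR]
        have := hkk 0 t (by omega)
        simp only [ρ]
        split_ifs <;> omega
      · by_cases hl : j = 2 * t - 1
        · have h1 := hkk j' t
          have h2 := hkk t j'
          have h3 := hke j' t
          have h4 := hke j' R
          simp only [ρ, κ, hl, if_true]
          split_ifs <;> omega
        · obtain ⟨h1, h2⟩ := hκb j' i' hi' hs
          have e : (j + 1) * k = j * k + k := by ring
          rcases lt_trichotomy j' j with h | rfl | h
          · have := hkk j' j h
            simp only [ρ, if_neg hl]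
            split_ifs <;> omega
          · have := hke j' R
            simp only [ρ, κ, if_neg hl]
            split_ifs <;> omega
          · rcases Nat.lt_or_ge (j + 1) j' with h' | h'
            · have := hkk (j + 1) j' h'
              simp only [ρ, if_neg hl]
              split_ifs <;> omega
            · obtain rfl : j' = j + 1 := by omega
              have := hke (j + 1) R
              simp only [ρ, κ, if_neg hl]
              split_ifs <;> omega
    have hρinj : ∀ j j', j < j' → j' < 2 * t → ρ j ≠ ρ j' := by
      intro j j' h hj'
      have h1 := hkk j j' h
      have h2 := hkk j t
      have h3 := hkk t j
      have h4 := hke j t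
      have h5 := hkk j R
      have h6 := hkk R t hRt
      simp only [ρ]
      split_ifs <;> omega
    have hκinj : ∀ j j' i i', i < lam → i' < lam → j < j' → κ j i ≠ κ j' i' := by
      intro j j' i i' hi hi' h
      have h1 := hkk j j' h
      by_cases hs : j = R ∧ i = 0
      · rw [hs.1, hs.2, hκR]
        exact (hκ0 j' i' (by omega)).ne
      · by_cases hs' : j' = R ∧ i' = 0
        · rw [hs'.1, hs'.2, hκR]
          exact (hκ0 j i hs).ne'
        · have := hκb j i hi hs
          have := hκb j' i' hi' hs'
          omega
    rintro (⟨j, hj⟩ | ⟨⟨j, hj⟩, i, hi⟩) (⟨j', hj'⟩ | ⟨⟨j', hj'⟩, i', hi'⟩) h <;>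
      simp only [edgeValue] at h
    · rcases lt_trichotomy j j' with hlt | rfl | hlt
      · exact (hρinj _ _ hlt hj' h).elim
      · rfl
      · exact (hρinj _ _ hlt hj h.symm).elim
    · exact (hne _ _ _ hj hi' h).elim
    · exact (hne _ _ _ hj' hi h.symm).elim
    · rcases lt_trichotomy j j' with hlt | rfl | hlt
      · exact (hκinj _ _ _ _ hi hi' hlt h).elim
      · have : i = i' := by
          simp only [κ] at h
          split_ifs at h <;> omega
        subst this; rfl
      · exact (hκinj _ _ _ _ hi' hi hlt h.symm).elim

/-- The decomposition when `t` is odd and is the least positive `j` with `m ∣ j * (lam + 1)`. -/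
theorem exists_cyclic_decomposition_of_minimal (t lam d m n : ℕ) (ht : 2 ≤ t) (hlam : 1 ≤ lam)
    (hd : 0 < d) (hm : 0 < m) (hn : 0 < n) (hdm : 2 * t * (lam + 1) = d * m) (hodd : Odd t)
    (hdvd : m ∣ t * (lam + 1)) (hmin : ∀ j, 0 < j → j < t → ¬ m ∣ j * (lam + 1)) :
    ∃ B : Set (SimpleGraph.completeEquipartiteGraph (m + 1) (2 * d * n)).Subgraph,
      IsDecomposition (hairyCycle t lam)
        (SimpleGraph.completeEquipartiteGraph (m + 1) (2 * d * n)) B ∧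
      IsCyclicFamily (SimpleGraph.completeEquipartiteGraph (m + 1) (2 * d * n)) B := by
  obtain ⟨k, hk⟩ : ∃ k, k = lam + 1 := ⟨_, rfl⟩
  rw [← hk] at hdm hdvd hmin
  have ht3 : 3 ≤ t := by rw [Nat.odd_iff] at hodd; omega
  have hkk : ∀ a b, a < b → a * k + k ≤ b * k := fun a b h => by
    have := Nat.mul_le_mul_right k (show a + 1 ≤ b from h)
    rwa [add_mul, one_mul] at this
  have hke : ∀ a b, a = b → a * k = b * k := fun a b h => by rw [h]
  have hdm' : d * m = t * k + t * k := by rw [← hdm]; ring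
  -- Otherwise `m` divides 1, hence `k`, contradicting minimality of `t > 1`.
  have hm1 : ¬ m ∣ t * k + 1 := fun h => by
    have h1 : m ∣ 1 := (Nat.dvd_add_right hdvd).1 h
    exact hmin 1 one_pos (by omega) (h1.trans (one_dvd _))
  -- Shifting edge `t - 1` by one would collide with the closing rank `t * k`. It takes `t * k + 1`
  -- instead, the usual rank of hair 0 at `t`, which in turn gets rank `k`, freed by moving the
  -- blocks from 1 on; block 0 stays.
  let ρ : ℕ → ℕ := fun j => if j = 2 * t - 1 then t * k else if j = 0 then k - 1 else
    if j = t - 1 then t * k + 1 else j * k + k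
  let κ : ℕ → ℕ → ℕ := fun j i => if j = 0 then i else
    if j = t then (if i = 0 then k else t * k + 1 + i) else j * k + 1 + i
  have hD := nonMultiple_strictAnti d m
  have hmono : ∀ j, j + 2 < 2 * t → ρ j < ρ (j + 1) := by
    intro j hj
    have e : (j + 1) * k = j * k + k := by ring
    have h1 := hke (j + 1) t
    have h2 := hkk (j + 1) t
    have h3 := hke j 0
    simp only [ρ, e, zero_mul] at h1 h2 h3 ⊢
    split_ifs <;> first | contradiction | omega
  have hgap : ∀ j, 0 < j → j < t →
      nonMultiple d m (j * k - 1) - nonMultiple d m (j * k) = 1 := by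
    intro j h0 hj
    have h1 : j * k - 1 + 1 = j * k := Nat.sub_add_cancel (Nat.mul_pos h0 (by omega))
    have := nonMultiple_sub_succ d m (j * k - 1)
    rwa [h1, if_neg (hmin j h0 hj), add_zero] at this
  refine exists_cyclic_decomposition_of_ranks t lam d m n (by omega) hd hm hn (by rw [← hk, hdm])
    ρ κ (fun j i => j = t ∧ i = 0) ?_ hmono ?_ ?_ ?_ ?_ ?_ ?_
  · obtain ⟨u, rfl⟩ : ∃ u, t = u + 1 := ⟨t - 1, by omega⟩
    have hu : Even u := by
      rw [← Nat.not_even_iff_odd, Nat.even_add_one, not_not] at hodd; exact hodd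
    have hρ : ∀ j, u < j → j ≤ 2 * u → ρ j = (j + 1) * k := by
      intro j h1 h2
      simp only [ρ, add_mul, one_mul]
      split_ifs <;> omega
    have hρu : ρ u = (u + 1) * k + 1 := by
      simp only [ρ]
      split_ifs <;> omega
    have hρlast : ρ (2 * (u + 1) - 1) = (u + 1) * k := by simp [ρ]
    -- The correction is 0 at `j = 0` and 1 at the `u - 1` further terms, an odd number, so 1
    -- survives: exactly the gap between ranks `t * k` and `t * k + 1`.
    have hsum : ∑ j ∈ Finset.range u, (-1) ^ j * (((d * (m + 1) : ℕ) : ℤ) -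
        (nonMultiple d m ((j + 1) * k - 1) - nonMultiple d m (ρ j))) = 1 := by
      obtain ⟨v, rfl⟩ : ∃ v, u = v + 1 := ⟨u - 1, by omega⟩
      have h1 := sum_neg_one_pow_mul_const (v + 1) (((d * (m + 1) : ℕ) : ℤ) - 1)
      rw [if_pos hu, Finset.sum_range_succ'] at h1
      rw [Finset.sum_range_succ']
      have h2 : ∑ j ∈ Finset.range v, (-1) ^ (j + 1) * (((d * (m + 1) : ℕ) : ℤ) -
          (nonMultiple d m ((j + 1 + 1) * k - 1) - nonMultiple d m (ρ (j + 1)))) =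
          ∑ j ∈ Finset.range v, (-1) ^ (j + 1) * (((d * (m + 1) : ℕ) : ℤ) - 1) := by
        refine Finset.sum_congr rfl fun j hj => ?_
        rw [Finset.mem_range] at hj
        have h3 : ρ (j + 1) = (j + 1 + 1) * k := by
          rw [add_mul _ 1 k, one_mul]
          simp only [ρ]
          split_ifs <;> first | contradiction | omega
        rw [h3, hgap _ (by omega) (by omega)]
      have h4 : ρ 0 = (0 + 1) * k - 1 := by
        simp only [ρ]
        split_ifs <;> omega
      rw [h2, h4]
      linarith
    have hgap' := nonMultiple_sub_succ d m ((u + 1) * k)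
    rw [if_neg hm1] at hgap'
    rw [show 2 * (u + 1) - 1 = 2 * u + 1 by omega] at hρlast ⊢
    rw [zigzag_symm (by omega) hm hdm ρ hρ, hsum, hρlast, hρu, hu.neg_one_pow]
    linarith
  · intro j i hj hi hs
    have h1 := hkk 0 j
    have h2 := hke (j + 1) t
    rw [add_mul, one_mul] at h2
    simp only [ρ, κ]
    split_ifs <;> subst_vars <;> omega
  · intro j i hj hi hs
    have e : (j + 1) * k = j * k + k := by ring
    have h2 := hke (j + 1) t
    have h3 := hke j 0
    simp only [ρ, κ, e, zero_mul] at h2 h3 ⊢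
    split_ifs <;> first | contradiction | omega
  · rintro j i hj hi ⟨rfl, rfl⟩
    refine ⟨Nat.not_even_iff_odd.2 hodd, ?_⟩
    -- Index 1 would not do: that label is `D (k - 1)`, which exceeds the hair's `D k` by 1. The
    -- next double step drops by at least `k ≥ 2`.
    have h1 : zigzag (nonMultiple d m) ρ j ≤ zigzag (nonMultiple d m) ρ 3 :=
      zigzag_odd_le hD.antitone (fun l hl => (hmono l (by omega)).le) (by decide) hodd ht3
    refine h1.trans_lt ?_
    have h0 : ρ 0 = 1 * k - 1 := by
      simp only [ρ]
      split_ifs <;> omega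
    have h2 : ρ 1 = 2 * k := by
      simp only [ρ]
      split_ifs <;> first | contradiction | omega
    have h3 : 2 * k + k ≤ ρ 2 := by
      have := hkk 2 j (by omega)
      simp only [ρ]
      split_ifs <;> first | contradiction | omega
    have h4 : κ j 0 = 1 * k := by
      simp only [κ]
      split_ifs <;> omega
    have h5 := nonMultiple_add_le d m (show 2 * k ≤ ρ 2 by omega)
    have h6 := hgap 1 one_pos (by omega)
    have h7 : ((k : ℕ) : ℤ) ≤ (ρ 2 - 2 * k : ℕ) := by omega
    have h8 : (2 : ℤ) ≤ k := by omega
    rw [h4, zigzag_add_two _ _ odd_one, h2]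
    simp only [zigzag, Finset.sum_range_one, pow_zero, one_mul] at h6 ⊢
    rw [h0, one_mul]
    linarith
  · rintro j i j' i' ⟨h, -⟩ ⟨h', -⟩
    rw [h, h']
  · have ht0 := hkk 2 t (by omega)
    rintro (⟨j, hj⟩ | ⟨⟨j, hj⟩, i, hi⟩) <;> simp only [edgeValue, hdm', ρ, κ]
    · have h1 := hkk j (2 * t - 1)
      have e : (2 * t - 1) * k = t * k + t * k - k := by rw [Nat.sub_mul, one_mul]; ring_nf
      split_ifs <;> omega
    · have h1 := hkk j (2 * t) hj
      have e : 2 * t * k = t * k + t * k := by ring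
      have h2 := hke j t
      split_ifs <;> omega
  · have ht0 := hkk 2 t (by omega)
    have hκb : ∀ j i, 0 < j → i < lam → ¬ (j = t ∧ i = 0) →
        j * k < κ j i ∧ κ j i < j * k + k := by
      intro j i h0 hi hs
      have := hke j t
      simp only [κ]
      split_ifs <;> omega
    have hκ0 : ∀ i, κ 0 i = i := fun i => by simp [κ]
    have hκt : κ t 0 = k := by
      simp only [κ]
      split_ifs <;> omega
    have hκk : ∀ j i, i < lam → ¬ (j = t ∧ i = 0) → κ j i ≠ k := by
      intro j i hi hs
      rcases Nat.eq_zero_or_pos j with rfl | h0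
      · rw [hκ0]; omega
      · have h1 := hκb j i h0 hi hs
        have h2 := hkk 0 j h0
        omega
    have hne : ∀ j j' i', j < 2 * t → i' < lam → ρ j ≠ κ j' i' := by
      intro j j' i' hj hi'
      by_cases hs : j' = t ∧ i' = 0
      · rw [hs.1, hs.2, hκt]
        have := hkk 0 j
        simp only [ρ]
        split_ifs <;> omega
      · rcases Nat.eq_zero_or_pos j' with rfl | h0
        · rw [hκ0]
          simp only [ρ]
          split_ifs <;> omega
        · have h1 := hκb j' i' h0 hi' hs
          have h2 := hkk 0 j' h0
          have h3 : ∀ c, κ j' i' ≠ c * k := by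
            intro c
            have h4 := hkk j' c
            have h5 := hkk c j'
            have h6 := hke c j'
            omega
          have h4 := h3 t
          have h5 := h3 (j + 1)
          rw [add_mul, one_mul] at h5
          by_cases hj1 : j = t - 1 ∧ j ≠ 2 * t - 1 ∧ j ≠ 0
          · have h6 := hkk j' t
            have h7 := hkk t j'
            have h8 := hke j' t
            simp only [ρ, κ]
            split_ifs <;> omega
          · simp only [ρ]
            split_ifs <;> omega
    have hρinj : ∀ j j', j < j' → j' < 2 * t → ρ j ≠ ρ j' := by
      intro j j' h hj'
      have h1 := hkk j j' h
      have h2 := hkk (t - 1) j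
      have h3 := hkk j (t - 1)
      have h4 := hkk (t - 1) j'
      have h5 : (t - 1) * k + k = t * k := by
        rw [← Nat.succ_mul, Nat.succ_eq_add_one, Nat.sub_add_cancel (by omega)]
      have h6 := hkk t j'
      have h7 := hke j' t
      have h8 := hkk 0 j'
      have h9 := hke j (t - 1)
      simp only [ρ]
      split_ifs <;> omega
    have hκinj : ∀ j j' i i', i < lam → i' < lam → j < j' → κ j i ≠ κ j' i' := by
      intro j j' i i' hi hi' h
      by_cases hs : j = t ∧ i = 0
      · rw [hs.1, hs.2, hκt]
        exact (hκk j' i' hi' (by omega)).symm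
      · by_cases hs' : j' = t ∧ i' = 0
        · rw [hs'.1, hs'.2, hκt]
          exact hκk j i hi hs
        · have h1 := hκb j' i' (by omega) hi' hs'
          have h2 := hkk j j' h
          rcases Nat.eq_zero_or_pos j with rfl | h0
          · rw [hκ0]; omega
          · have := hκb j i h0 hi hs
            omega
    rintro (⟨j, hj⟩ | ⟨⟨j, hj⟩, i, hi⟩) (⟨j', hj'⟩ | ⟨⟨j', hj'⟩, i', hi'⟩) h <;>
      simp only [edgeValue] at h
    · rcases lt_trichotomy j j' with hlt | rfl | hlt
      · exact (hρinj _ _ hlt hj' h).elim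
      · rfl
      · exact (hρinj _ _ hlt hj h.symm).elim
    · exact (hne _ _ _ hj hi' h).elim
    · exact (hne _ _ _ hj' hi h.symm).elim
    · rcases lt_trichotomy j j' with hlt | rfl | hlt
      · exact (hκinj _ _ _ _ hi hi' hlt h).elim
      · have : i = i' := by
          simp only [κ] at h
          split_ifs at h <;> omega
        subst this; rfl
      · exact (hκinj _ _ _ _ hi' hi hlt h.symm).elim

/-! ### Choice of the assignment. -/

theorem mainTheorem4 (t lam d n : ℕ) (ht : 2 ≤ t) (hlam : 1 ≤ lam)
    (hd : d ∣ 2 * t * (lam + 1)) (hn : 1 ≤ n) :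
    ∃ B : Set (SimpleGraph.completeEquipartiteGraph
        (2 * t * (lam + 1) / d + 1) (2 * d * n)).Subgraph,
      IsDecomposition (hairyCycle t lam)
        (SimpleGraph.completeEquipartiteGraph (2 * t * (lam + 1) / d + 1) (2 * d * n)) B ∧
      IsCyclicFamily
        (SimpleGraph.completeEquipartiteGraph (2 * t * (lam + 1) / d + 1) (2 * d * n)) B := by
  obtain ⟨m, hdm⟩ := hd
  have he : 0 < d * m := by rw [← hdm]; positivity
  have hd0 : 0 < d := Nat.pos_of_mul_pos_right he
  have hm0 : 0 < m := Nat.pos_of_mul_pos_left he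
  rw [hdm, Nat.mul_div_cancel_left m hd0]
  have shift := exists_cyclic_decomposition_of_shift t lam d m n
  rcases Nat.even_or_odd t with hev | hodd
  · exact shift 0 ht hlam hd0 hm0 hn hdm (Or.inl ⟨hev, rfl⟩)
  by_cases hmt : m ∣ t * (lam + 1)
  · have hex : ∃ j, 0 < j ∧ m ∣ j * (lam + 1) := ⟨t, by omega, hmt⟩
    classical
    obtain ⟨hR0, hRm⟩ := Nat.find_spec hex
    have hmin : ∀ j, 0 < j → j < Nat.find hex → ¬ m ∣ j * (lam + 1) :=
      fun j h0 hj h => Nat.find_min hex hj ⟨h0, h⟩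
    have hle : Nat.find hex ≤ t := Nat.find_min' hex ⟨by omega, hmt⟩
    generalize Nat.find hex = R at *
    rcases hle.lt_or_eq with hlt | rfl
    · have hRt : R ∣ t := by
        by_contra h
        have h1 : 0 < t % R := Nat.pos_of_ne_zero fun h0 => h (Nat.dvd_of_mod_eq_zero h0)
        refine hmin _ h1 (Nat.mod_lt _ hR0) ?_
        have h2 : t * (lam + 1) = t / R * (R * (lam + 1)) + t % R * (lam + 1) := by
          conv_lhs => rw [← Nat.div_add_mod t R]
          ring
        rw [h2] at hmt
        exact (Nat.dvd_add_right (hRm.mul_left _)).1 hmt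
      exact shift R ht hlam hd0 hm0 hn hdm
        (Or.inr ⟨hodd, hodd.of_dvd_nat hRt, hlt, hmin, iff_of_true hRm hmt⟩)
    · exact exists_cyclic_decomposition_of_minimal R lam d m n ht hlam hd0 hm0 hn hdm hodd hmt hmin
  -- Here `m ∤ t * k` forces `m ∤ k`, so both gaps are 1 and one shifted edge suffices.
  · exact shift 1 ht hlam hd0 hm0 hn hdm (Or.inr ⟨hodd, odd_one, by omega, fun j _ _ => by omega,
      iff_of_false (fun h => hmt ((one_mul (lam + 1) ▸ h).mul_left t)) hmt⟩)
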